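/- Let $\mathbb{X}\subset\mathbb{R}$ be a closed set that is unbounded above, with jump operators $\sigma(t)=\inf\{s\in\mathbb{X}:s>t\}$ and $\rho(t)=\sup\{s\in\mathbb{X}:s<t\}$ (with $\rho(\min\mathbb{X})=\min\mathbb{X}$ if the minimum exists) and graininess $\mu(t)=\sigma(t)-t$. Let $t_0\in\mathbb{X}$, write $[a,\infty)_{\mathbb{X}}=[a,\infty)\cap\mathbb{X}$, and assume the Sturmian condition $\sigma(\rho(t))=\rho(\sigma(t))=t$ for all $t\in[t_0,\infty)_{\mathbb{X}}$. Let $A_1,A_2,B_1,B_2,B_3,B_4:[t_0,\infty)_{\mathbb{X}}\to\mathbb{C}^{n\times n}$ be rd-continuous, put $$A=\begin{pmatrix}A_1&0\\0&A_2\end{pmatrix},\qquad B=\begin{pmatrix}B_1&B_2\\B_3&B_4\end{pmatrix},\qquad J=\begin{pmatrix}0&-I_n\\I_n&0\end{pmatrix},$$ and assume that $A(t)$ is Hermitian and positive semidefinite and that $I_n+\mu(t)B_2(t)$ and $I_n+\mu(t)B_3(t)$ are invertible for every $t\in[t_0,\infty)_{\mathbb{X}}$. For $y=(y_1,y_2)^{T}$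 with $y_1:[t_0,\infty)_{\mathbb{X}}\to\mathbb{C}^n$ and $y_2:[\rho(t_0),\infty)_{\mathbb{X}}\to\mathbb{C}^n$, let $\widehat y(t)=(y_1(t),y_2(\rho(t)))^{T}$ for $t\in[t_0,\infty)_{\mathbb{X}}$. Let $\mathbb{D}$ be the space of those $y$ for which $y_1$ and $y_2\circ\rho$ are delta differentiable on $[t_0,\infty)_{\mathbb{X}}$ and which are locally $A$-square integrable, that is, $y$ is $\Delta$-measurable and $\int_{[t_0,b)_{\mathbb{X}}}y^*(t)A(t)y(t)\,\Delta t<\infty$ for every real $b$. Then for every $\lambda\in\mathbb{C}$ and all $c_1,c_2\in\mathbb{C}^n$, the Hamiltonian system $$J\,\widehat y^{\,\Delta}(t)=\bigl(\lambda A(t)+B(t)\bigr)y(t),\qquad t\in[t_0,\infty)_{\mathbb{X}},$$ has exactly one solution $y\in\mathbb{D}$ with $\widehat y(t_0)=(c_1,c_2)^{T}$. This $y$ is moreover the only solution of the initial value problem among all $y$ with $\widehat y$ delta differentiable on $[t_0,\infty)_{\mathbb{X}}$: any other such solution agrees with it, $y_1$ on $[t_0,\infty)_{\mathbb{X}}$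 and $y_2$ on $[\rho(t_0),\infty)_{\mathbb{X}}$. -/

import Mathlib

open MeasureTheory Filter Topology Asymptotics
open scoped ComplexOrder

noncomputable section

namespace TimeScale

open Classical in
/-- The forward jump `σ(t) = inf {s ∈ X : s > t}`, with the convention `σ(max X) = max X`. -/
def sigma (X : Set ℝ) (t : ℝ) : ℝ :=
  if (X ∩ Set.Ioi t).Nonempty then sInf (X ∩ Set.Ioi t) else t

open Classical in
/-- The backward jump `ρ(t) = sup {s ∈ X : s < t}`, with the convention `ρ(min X) = min X`. -/
def rho (X : Set ℝ) (t : ℝ) : ℝ :=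
  if (X ∩ Set.Iio t).Nonempty then sSup (X ∩ Set.Iio t) else t

/-- The graininess `μ(t) = σ(t) - t`. -/
def mu (X : Set ℝ) (t : ℝ) : ℝ := sigma X t - t

/-- The half line `[a, ∞)_X = [a, ∞) ∩ X`. -/
def Ray (X : Set ℝ) (a : ℝ) : Set ℝ := X ∩ Set.Ici a

/-- The Sturmian condition `σ(ρ(t)) = ρ(σ(t)) = t` for all `t ∈ [t₀, ∞)_X`. -/
def IsSturmian (X : Set ℝ) (t₀ : ℝ) : Prop :=
  ∀ t ∈ Ray X t₀, sigma X (rho X t) = t ∧ rho X (sigma X t) = t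

/-- `f` has delta derivative `f'` at the point `t` of the time scale `T`: for every `ε > 0`,
`‖f (σ t) - f s - (σ t - s) f'‖ ≤ ε |σ t - s|` for all `s ∈ T` near `t` (`s = t` included).
Only the values of `f` on `T` matter. -/
def HasDeltaDerivAt {E : Type*} [NormedAddCommGroup E] [NormedSpace ℝ E]
    (T : Set ℝ) (f : ℝ → E) (f' : E) (t : ℝ) : Prop :=
  (fun s : ℝ => f (sigma T t) - f s - (sigma T t - s) • f')
    =o[𝓝[T] t] (fun s : ℝ => sigma T t - s)

/-- `f` is delta differentiable on the time scale `T`. -/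
def DeltaDifferentiable {E : Type*} [NormedAddCommGroup E] [NormedSpace ℝ E]
    (T : Set ℝ) (f : ℝ → E) : Prop :=
  ∀ t ∈ T, ∃ f' : E, HasDeltaDerivAt T f f' t

/-- Rd-continuity on the time scale `T`: continuity at right-dense points and existence of
(finite) left limits at left-dense points. -/
def RdContinuous {E : Type*} [TopologicalSpace E] (T : Set ℝ) (f : ℝ → E) : Prop :=
  (∀ t ∈ T, sigma T t = t → ContinuousWithinAt f T t) ∧
  (∀ t ∈ T, rho T t = t → ∃ l : E, Tendsto f (𝓝[T ∩ Set.Iio t] t) (𝓝 l))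

/-- The Lebesgue delta measure of the time scale `X`: Lebesgue measure on `X`, plus a point mass
`μ(t)` at each right-scattered point `t`. -/
def deltaMeasure (X : Set ℝ) : Measure ℝ :=
  volume.restrict X +
    Measure.sum (fun t : {t : ℝ // t ∈ X ∧ t < sigma X t} =>
      ENNReal.ofReal (mu X t) • Measure.dirac (t : ℝ))

end TimeScale

namespace TimeScaleHamiltonian

open TimeScale

/-- The vector function `y = (y₁, y₂)ᵀ` with values in `ℂ²ⁿ`. -/
def vec {n : ℕ} (y₁ y₂ : ℝ → (Fin n → ℂ)) (t : ℝ) : Fin n ⊕ Fin n → ℂ :=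
  Sum.elim (y₁ t) (y₂ t)

/-- The partial left shift `ŷ = (y₁, y₂ ∘ ρ)ᵀ`. -/
def hat {n : ℕ} (X : Set ℝ) (y₁ y₂ : ℝ → (Fin n → ℂ)) (t : ℝ) : Fin n ⊕ Fin n → ℂ :=
  Sum.elim (y₁ t) (y₂ (rho X t))

/-- `y` satisfies `J ŷ^Δ(t) = (λ A(t) + B(t)) y(t)` for all `t ∈ [t₀, ∞)_X`, where the delta
derivative of `ŷ : [t₀, ∞)_X → ℂ²ⁿ` is part of the assertion. Here
`Matrix.J = !![0, -I; I, 0]`. -/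
def SatisfiesSystem {n : ℕ} (X : Set ℝ) (t₀ : ℝ)
    (A B : ℝ → Matrix (Fin n ⊕ Fin n) (Fin n ⊕ Fin n) ℂ) (lam : ℂ)
    (y₁ y₂ : ℝ → (Fin n → ℂ)) : Prop :=
  ∀ t ∈ Ray X t₀, ∃ d : Fin n ⊕ Fin n → ℂ,
    HasDeltaDerivAt (Ray X t₀) (hat X y₁ y₂) d t ∧
    Matrix.mulVec (Matrix.J (Fin n) ℂ) d = Matrix.mulVec (lam • A t + B t) (vec y₁ y₂ t)

/-- `y` is `A`-square integrable on `S ⊆ X`: it is delta measurable on `S` and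
`∫_S y*(t) A(t) y(t) Δt < ∞`. -/
def SquareIntegrableOn {n : ℕ} (X S : Set ℝ)
    (A : ℝ → Matrix (Fin n ⊕ Fin n) (Fin n ⊕ Fin n) ℂ) (y₁ y₂ : ℝ → (Fin n → ℂ)) : Prop :=
  AEStronglyMeasurable (vec y₁ y₂) ((deltaMeasure X).restrict S) ∧
  IntegrableOn
    (fun t : ℝ => dotProduct (star (vec y₁ y₂ t)) (Matrix.mulVec (A t) (vec y₁ y₂ t)))
    S (deltaMeasure X)

/-- The space `𝔻` of the functions `y = (y₁, y₂)ᵀ` that are `A`-square integrable on every bounded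
interval `[t₀, b)_X` and for which `y₁` and `y₂ ∘ ρ` are delta differentiable on `[t₀, ∞)_X`. -/
def MemD {n : ℕ} (X : Set ℝ) (t₀ : ℝ)
    (A : ℝ → Matrix (Fin n ⊕ Fin n) (Fin n ⊕ Fin n) ℂ) (y₁ y₂ : ℝ → (Fin n → ℂ)) : Prop :=
  (∀ b : ℝ, SquareIntegrableOn X (X ∩ Set.Ico t₀ b) A y₁ y₂) ∧
  DeltaDifferentiable (Ray X t₀) y₁ ∧
  DeltaDifferentiable (Ray X t₀) (fun t => y₂ (rho X t))

end TimeScaleHamiltonian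

end

namespace TimeScale

variable {X : Set ℝ} {t₀ s t : ℝ}

/-! ### Jump operators -/

theorem inter_Ioi_nonempty (hub : ¬ BddAbove X) (t : ℝ) : (X ∩ Set.Ioi t).Nonempty := by
  obtain ⟨s, hs, hts⟩ := not_bddAbove_iff.1 hub t
  exact ⟨s, hs, hts⟩

theorem sigma_eq_sInf (hub : ¬ BddAbove X) (t : ℝ) : sigma X t = sInf (X ∩ Set.Ioi t) :=
  if_pos (inter_Ioi_nonempty hub t)

theorem bddBelow_inter_Ioi : BddBelow (X ∩ Set.Ioi t) := ⟨t, fun _ h => le_of_lt h.2⟩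

theorem bddAbove_inter_Iio : BddAbove (X ∩ Set.Iio t) := ⟨t, fun _ h => le_of_lt h.2⟩

theorem le_sigma (hub : ¬ BddAbove X) (t : ℝ) : t ≤ sigma X t := by
  rw [sigma_eq_sInf hub]
  exact le_csInf (inter_Ioi_nonempty hub t) fun _ h => le_of_lt h.2

theorem sigma_le (hub : ¬ BddAbove X) (hs : s ∈ X) (hts : t < s) : sigma X t ≤ s := by
  rw [sigma_eq_sInf hub]
  exact csInf_le bddBelow_inter_Ioi ⟨hs, hts⟩

theorem sigma_mem (hX : IsClosed X) (hub : ¬ BddAbove X) (t : ℝ) : sigma X t ∈ X := by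
  rw [sigma_eq_sInf hub]
  exact closure_minimal Set.inter_subset_left hX
    (csInf_mem_closure (inter_Ioi_nonempty hub t) bddBelow_inter_Ioi)

theorem le_rho (hs : s ∈ X) (hst : s < t) : s ≤ rho X t := by
  rw [rho, if_pos ⟨s, hs, hst⟩]
  exact le_csSup bddAbove_inter_Iio ⟨hs, hst⟩

theorem rho_le (t : ℝ) : rho X t ≤ t := by
  unfold rho
  split_ifs with h
  · exact csSup_le h fun _ h => le_of_lt h.2
  · exact le_rfl

theorem rho_mem (hX : IsClosed X) (ht : t ∈ X) : rho X t ∈ X := by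
  unfold rho
  split_ifs with h
  · exact closure_minimal Set.inter_subset_left hX (csSup_mem_closure h bddAbove_inter_Iio)
  · exact ht

theorem exists_mem_Ioo_of_sigma_eq (hub : ¬ BddAbove X) (h : sigma X t = t) {u : ℝ}
    (hu : t < u) : ∃ s ∈ X, t < s ∧ s < u := by
  rw [sigma_eq_sInf hub] at h
  obtain ⟨s, hs, hsu⟩ := exists_lt_of_csInf_lt (inter_Ioi_nonempty hub t) (h.trans_lt hu)
  exact ⟨s, hs.1, hs.2, hsu⟩

theorem exists_mem_Ioo_of_rho_eq (h : rho X t = t) (hs : s ∈ X) (hst : s < t) {u : ℝ}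
    (hu : u < t) : ∃ r ∈ X, u < r ∧ r < t := by
  rw [rho, if_pos ⟨s, hs, hst⟩] at h
  have hne : (X ∩ Set.Iio t).Nonempty := ⟨s, hs, hst⟩
  obtain ⟨r, hr, hur⟩ := exists_lt_of_lt_csSup hne (hu.trans_eq h.symm)
  exact ⟨r, hr.1, hur, hr.2⟩

/-! ### Half lines -/

theorem isClosed_Ray (hX : IsClosed X) : IsClosed (Ray X t₀) := hX.inter isClosed_Ici

theorem sigma_Ray (ht : t ∈ Ray X t₀) : sigma (Ray X t₀) t = sigma X t := by
  have : Ray X t₀ ∩ Set.Ioi t = X ∩ Set.Ioi t := by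
    ext s
    exact ⟨fun h => ⟨h.1.1, h.2⟩, fun h => ⟨⟨h.1, show t₀ ≤ s from le_trans ht.2 (le_of_lt h.2)⟩, h.2⟩⟩
  unfold sigma
  rw [this]

theorem sigma_mem_Ray (hX : IsClosed X) (hub : ¬ BddAbove X) (ht : t ∈ Ray X t₀) :
    sigma X t ∈ Ray X t₀ :=
  ⟨sigma_mem hX hub t, ht.2.trans (le_sigma hub t)⟩

/-! ### The Sturmian condition -/

theorem IsSturmian.rho_eq (hS : IsSturmian X t₀) (ht : t ∈ Ray X t₀) (h : sigma X t = t) :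
    rho X t = t := by
  simpa only [h] using (hS t ht).2

theorem IsSturmian.rho_lt (hS : IsSturmian X t₀) (ht : t ∈ Ray X t₀) (h : t < sigma X t) :
    rho X t < t := by
  refine lt_of_le_of_ne (rho_le t) fun h' => ?_
  have := (hS t ht).1
  rw [h'] at this
  exact h.ne' this

/-- A right-dense point is a limit from the left unless it is the initial point. -/
theorem IsSturmian.exists_mem_Ioo_left (hS : IsSturmian X t₀) (ht₀ : t₀ ∈ X) (ht : t ∈ Ray X t₀)
    (h : sigma X t = t) (h₀ : t₀ < t) {u : ℝ} (hu : u < t) :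
    ∃ s ∈ Ray X t₀, u < s ∧ s < t := by
  obtain ⟨s, hs, hus, hst⟩ :=
    exists_mem_Ioo_of_rho_eq (hS.rho_eq ht h) ht₀ h₀ (max_lt hu h₀)
  exact ⟨s, ⟨hs, ((le_max_right _ _).trans_lt hus).le⟩, (le_max_left _ _).trans_lt hus, hst⟩

theorem IsSturmian.nhdsWithin_eq_pure (hub : ¬ BddAbove X) (hS : IsSturmian X t₀)
    (ht : t ∈ Ray X t₀) (h : t < sigma X t) : 𝓝[Ray X t₀] t = pure t := by
  refine le_antisymm ?_ (pure_le_nhdsWithin ht)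
  rw [le_pure_iff]
  filter_upwards [self_mem_nhdsWithin,
    mem_nhdsWithin_of_mem_nhds (Ioo_mem_nhds (hS.rho_lt ht h) h)] with s hs hs'
  rcases lt_trichotomy s t with hlt | rfl | hgt
  · exact absurd (le_rho hs.1 hlt) hs'.1.not_ge
  · rfl
  · exact absurd (sigma_le hub hs.1 hgt) hs'.2.not_ge

/-- On a Sturmian time scale rd-continuity is continuity. -/
theorem RdContinuous.continuousOn {E : Type*} [TopologicalSpace E] {f : ℝ → E}
    (hub : ¬ BddAbove X) (hS : IsSturmian X t₀) (hf : RdContinuous (Ray X t₀) f) :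
    ContinuousOn f (Ray X t₀) := by
  intro t ht
  rcases (le_sigma hub t).eq_or_lt with h | h
  · exact hf.1 t ht ((sigma_Ray ht).trans h.symm)
  · rw [ContinuousWithinAt, hS.nhdsWithin_eq_pure hub ht h]
    exact tendsto_pure_nhds f t

theorem IsSturmian.continuousOn_sigma (hub : ¬ BddAbove X) (hS : IsSturmian X t₀) :
    ContinuousOn (sigma X) (Ray X t₀) := by
  intro t ht
  rcases (le_sigma hub t).eq_or_lt with h | h
  · rw [ContinuousWithinAt, ← h]
    refine tendsto_order.2 ⟨fun u hu => ?_, fun u hu => ?_⟩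
    · filter_upwards [mem_nhdsWithin_of_mem_nhds (Ioi_mem_nhds hu)] with s hs
      exact lt_of_lt_of_le hs (le_sigma hub s)
    · obtain ⟨r, hr, htr, hru⟩ := exists_mem_Ioo_of_sigma_eq hub h.symm hu
      filter_upwards [mem_nhdsWithin_of_mem_nhds (Iio_mem_nhds htr)] with s hs
      exact (sigma_le hub hr hs).trans_lt hru
  · rw [ContinuousWithinAt, hS.nhdsWithin_eq_pure hub ht h]
    exact tendsto_pure_nhds _ t

/-! ### Delta derivatives -/

section DeltaDeriv

variable {E F : Type*} [NormedAddCommGroup E] [NormedSpace ℝ E] [NormedAddCommGroup F]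
  [NormedSpace ℝ F] {T : Set ℝ} {f g : ℝ → E} {f' g' : E}

theorem HasDeltaDerivAt.sub (hf : HasDeltaDerivAt T f f' t) (hg : HasDeltaDerivAt T g g' t) :
    HasDeltaDerivAt T (fun x => f x - g x) (f' - g') t := by
  refine (IsLittleO.sub hf hg).congr_left fun s => ?_
  simp only [smul_sub]
  abel

theorem HasDeltaDerivAt.clm_comp (L : E →L[ℝ] F) (hf : HasDeltaDerivAt T f f' t) :
    HasDeltaDerivAt T (fun x => L (f x)) (L f') t := by
  refine ((L.isBigO_comp _ _).trans_isLittleO hf).congr_left fun s => ?_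
  simp only [map_sub, map_smul]

theorem HasDeltaDerivAt.congr (hf : HasDeltaDerivAt T f f' t) (ht : sigma T t ∈ T)
    (h : Set.EqOn g f T) : HasDeltaDerivAt T g f' t := by
  refine IsLittleO.congr' hf ?_ EventuallyEq.rfl
  filter_upwards [self_mem_nhdsWithin] with s hs
  rw [h hs, h ht]

theorem HasDeltaDerivAt.apply_sigma (hf : HasDeltaDerivAt T f f' t) (ht : t ∈ T) :
    f (sigma T t) = f t + (sigma T t - t) • f' := by
  have h : ‖f (sigma T t) - f t - (sigma T t - t) • f'‖ ≤ 0 := by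
    refine le_of_forall_pos_le_add fun ε hε => ?_
    have hδ : 0 < ε / (‖sigma T t - t‖ + 1) := by positivity
    refine ((hf.def hδ).self_of_nhdsWithin ht).trans ?_
    rw [zero_add, div_mul_eq_mul_div, div_le_iff₀ (by positivity)]
    nlinarith
  rw [norm_le_zero_iff] at h
  rw [← sub_eq_zero, ← h]
  abel

theorem HasDeltaDerivAt.continuousWithinAt (hub : ¬ BddAbove X) (hS : IsSturmian X t₀)
    (ht : t ∈ Ray X t₀) (hf : HasDeltaDerivAt (Ray X t₀) f f' t) :
    ContinuousWithinAt f (Ray X t₀) t := by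
  rcases (le_sigma hub t).eq_or_lt with h | h
  · unfold HasDeltaDerivAt at hf
    rw [sigma_Ray ht, ← h] at hf
    have h₀ : Tendsto (fun s : ℝ => t - s) (𝓝[Ray X t₀] t) (𝓝 0) := by
      have : Tendsto (fun s : ℝ => t - s) (𝓝 t) (𝓝 (t - t)) :=
        (continuous_const.sub continuous_id).tendsto t
      rw [sub_self] at this
      exact this.mono_left nhdsWithin_le_nhds
    have h₁ := (hf.trans_tendsto h₀).add (h₀.smul_const f')
    have h₂ := (tendsto_const_nhds (x := f t)).sub h₁
    simpa [ContinuousWithinAt] using h₂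
  · rw [ContinuousWithinAt, hS.nhdsWithin_eq_pure hub ht h]
    exact tendsto_pure_nhds _ t

end DeltaDeriv

end TimeScale

namespace TimeScale

variable {X : Set ℝ} {t₀ s t : ℝ}

/-! ### The projection of the real line onto a half line of a time scale -/

/-- The largest point of `[t₀, ∞)_X` not exceeding `r`, or `t₀` if there is none. -/
noncomputable def floor (X : Set ℝ) (t₀ r : ℝ) : ℝ := sSup (Ray X t₀ ∩ Set.Iic (max r t₀))

theorem floor_set_nonempty (ht₀ : t₀ ∈ X) (r : ℝ) :
    (Ray X t₀ ∩ Set.Iic (max r t₀)).Nonempty :=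
  ⟨t₀, ⟨ht₀, Set.self_mem_Ici⟩, le_max_right r t₀⟩

theorem floor_set_bddAbove (r : ℝ) : BddAbove (Ray X t₀ ∩ Set.Iic (max r t₀)) :=
  ⟨max r t₀, fun _ h => h.2⟩

theorem floor_mem_inter (hX : IsClosed X) (ht₀ : t₀ ∈ X) (r : ℝ) :
    floor X t₀ r ∈ Ray X t₀ ∩ Set.Iic (max r t₀) :=
  ((isClosed_Ray hX).inter isClosed_Iic).csSup_mem (floor_set_nonempty ht₀ r)
    (floor_set_bddAbove r)

theorem floor_mem (hX : IsClosed X) (ht₀ : t₀ ∈ X) (r : ℝ) : floor X t₀ r ∈ Ray X t₀ :=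
  (floor_mem_inter hX ht₀ r).1

theorem floor_le (hX : IsClosed X) (ht₀ : t₀ ∈ X) (r : ℝ) : floor X t₀ r ≤ max r t₀ :=
  (floor_mem_inter hX ht₀ r).2

theorem le_floor {r : ℝ} (ht : t ∈ Ray X t₀) (htr : t ≤ r) : t ≤ floor X t₀ r :=
  le_csSup (floor_set_bddAbove r) ⟨ht, htr.trans (le_max_left r t₀)⟩

theorem floor_monotone (ht₀ : t₀ ∈ X) : Monotone (floor X t₀) := fun r r' h =>
  csSup_le_csSup (floor_set_bddAbove r') (floor_set_nonempty ht₀ r)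
    (Set.inter_subset_inter_right _ (Set.Iic_subset_Iic.2 (max_le_max_right t₀ h)))

theorem floor_eq_self (hX : IsClosed X) (ht₀ : t₀ ∈ X) (ht : t ∈ Ray X t₀) :
    floor X t₀ t = t :=
  le_antisymm ((floor_le hX ht₀ t).trans_eq (max_eq_left ht.2)) (le_floor ht le_rfl)

theorem floor_eq_of_lt_sigma (hX : IsClosed X) (hub : ¬ BddAbove X) (ht₀ : t₀ ∈ X)
    (ht : t ∈ Ray X t₀) {r : ℝ} (htr : t ≤ r) (hr : r < sigma X t) : floor X t₀ r = t := by
  refine le_antisymm (not_lt.1 fun h => ?_) (le_floor ht htr)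
  refine (sigma_le hub (floor_mem hX ht₀ r).1 h).not_gt ?_
  exact ((floor_le hX ht₀ r).trans_eq (max_eq_left (le_trans ht.2 htr))).trans_lt hr

theorem IsSturmian.continuousAt_floor (hX : IsClosed X) (ht₀ : t₀ ∈ X)
    (hS : IsSturmian X t₀) (ht : t ∈ Ray X t₀) (h : sigma X t = t) :
    ContinuousAt (floor X t₀) t := by
  rw [ContinuousAt, floor_eq_self hX ht₀ ht]
  refine tendsto_order.2 ⟨fun u hu => ?_, fun u hu => ?_⟩
  · rcases (show t₀ ≤ t from ht.2).eq_or_lt with rfl | h₀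
    · exact Eventually.of_forall fun r => hu.trans_le (floor_mem hX ht₀ r).2
    · obtain ⟨s, hs, hus, hst⟩ := hS.exists_mem_Ioo_left ht₀ ht h h₀ hu
      filter_upwards [Ioi_mem_nhds hst] with r hr
      exact hus.trans_le (le_floor hs (le_of_lt hr))
  · filter_upwards [Iio_mem_nhds hu] with r hr
    exact (floor_le hX ht₀ r).trans_lt (max_lt hr (lt_of_le_of_lt ht.2 hu))

section Integral

variable {E : Type*} [NormedAddCommGroup E] [SecondCountableTopology E] {h : ℝ → E}

theorem isCompact_Ray_inter_Iic (hX : IsClosed X) (b : ℝ) :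
    IsCompact (Ray X t₀ ∩ Set.Iic b) := by
  have : Ray X t₀ ∩ Set.Iic b = Set.Icc t₀ b ∩ X := by
    ext s
    exact ⟨fun h => ⟨⟨h.1.2, h.2⟩, h.1.1⟩, fun h => ⟨⟨h.2, h.1.1⟩, h.1.2⟩⟩
  rw [this]
  exact isCompact_Icc.inter_right hX

theorem stronglyMeasurable_comp_floor (hX : IsClosed X) (ht₀ : t₀ ∈ X)
    (hh : ContinuousOn h (Ray X t₀)) : StronglyMeasurable fun r => h (floor X t₀ r) := by
  classical
  borelize E
  have h₁ : Measurable ((Ray X t₀).piecewise h fun _ => 0) :=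
    hh.measurable_piecewise continuousOn_const (isClosed_Ray hX).measurableSet
  have h₂ := (h₁.comp (floor_monotone ht₀).measurable).stronglyMeasurable
  convert h₂ using 2 with r
  exact (Set.piecewise_eq_of_mem _ _ _ (floor_mem hX ht₀ r)).symm

theorem intervalIntegrable_comp_floor (hX : IsClosed X) (ht₀ : t₀ ∈ X)
    (hh : ContinuousOn h (Ray X t₀)) (a b : ℝ) :
    IntervalIntegrable (fun r => h (floor X t₀ r)) volume a b := by
  obtain ⟨C, hC⟩ := (isCompact_Ray_inter_Iic hX (max (max a b) t₀)).exists_bound_of_continuousOn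
    (hh.mono Set.inter_subset_left)
  refine (intervalIntegrable_const (c := C)).mono_fun
    (stronglyMeasurable_comp_floor hX ht₀ hh).aestronglyMeasurable ?_
  refine (ae_restrict_iff' measurableSet_uIoc).2 (Eventually.of_forall fun r hr => ?_)
  refine (hC _ ⟨floor_mem hX ht₀ r, ?_⟩).trans (le_abs_self C)
  exact (floor_le hX ht₀ r).trans (max_le_max_right t₀ hr.2)

variable [NormedSpace ℝ E] [CompleteSpace E]

/-- The fundamental theorem of calculus for the delta integral on a Sturmian time scale. -/
theorem IsSturmian.hasDeltaDerivAt_integral (hX : IsClosed X) (hub : ¬ BddAbove X)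
    (ht₀ : t₀ ∈ X) (hS : IsSturmian X t₀) (hh : ContinuousOn h (Ray X t₀))
    (ht : t ∈ Ray X t₀) :
    HasDeltaDerivAt (Ray X t₀) (fun x => ∫ r in t₀..x, h (floor X t₀ r)) (h t) t := by
  have hint := intervalIntegrable_comp_floor hX ht₀ hh
  have hfl := floor_eq_self hX ht₀ ht
  unfold HasDeltaDerivAt
  rw [sigma_Ray ht]
  rcases (le_sigma hub t).eq_or_lt with hs | hs
  · rw [← hs]
    have hc : ContinuousAt (fun r => h (floor X t₀ r)) t := by
      have hfloor := hS.continuousAt_floor hX ht₀ ht hs.symm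
      rw [ContinuousAt, hfl] at hfloor
      rw [ContinuousAt, hfl]
      exact (hh t ht).tendsto.comp
        (tendsto_nhdsWithin_iff.2 ⟨hfloor, Eventually.of_forall (floor_mem hX ht₀)⟩)
    have hd := intervalIntegral.integral_hasDerivAt_right (hint t₀ t)
      (stronglyMeasurable_comp_floor hX ht₀ hh).stronglyMeasurableAtFilter hc
    rw [hfl] at hd
    refine ((hd.isLittleO.mono nhdsWithin_le_nhds).neg_left.neg_right).congr (fun s => ?_)
      fun s => neg_sub s t
    rw [sub_smul, sub_smul]
    abel
  · rw [hS.nhdsWithin_eq_pure hub ht hs]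
    have heq : (∫ r in t₀..sigma X t, h (floor X t₀ r)) - ∫ r in t₀..t, h (floor X t₀ r) =
        (sigma X t - t) • h t := by
      rw [intervalIntegral.integral_interval_sub_left (hint _ _) (hint _ _),
        ← intervalIntegral.integral_const]
      refine intervalIntegral.integral_congr_ae ?_
      have hne : ∀ᵐ r : ℝ, r ≠ sigma X t := by simp [ae_iff]
      filter_upwards [hne] with r hr hr'
      rw [Set.uIoc_of_le hs.le] at hr'
      rw [floor_eq_of_lt_sigma hX hub ht₀ ht hr'.1.le (lt_of_le_of_ne hr'.2 hr)]
    refine isLittleO_iff.2 fun c hc => ?_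
    rw [eventually_pure, heq, sub_self, norm_zero]
    positivity

/-! ### Existence for linear dynamic equations -/

/-- The terms of the Picard (Peano–Baker) series of `w^Δ = S w`, `w t₀ = c`. -/
noncomputable def picard (X : Set ℝ) (t₀ : ℝ) (S : ℝ → E →L[ℝ] E) (c : E) : ℕ → ℝ → E
  | 0 => fun _ => c
  | k + 1 => fun x => ∫ r in t₀..x, S (floor X t₀ r) (picard X t₀ S c k (floor X t₀ r))

variable {S : ℝ → E →L[ℝ] E}

omit [CompleteSpace E] in
theorem continuous_picard (hX : IsClosed X) (ht₀ : t₀ ∈ X)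
    (hS : ContinuousOn S (Ray X t₀)) (c : E) (k : ℕ) : Continuous (picard X t₀ S c k) := by
  induction k with
  | zero => exact continuous_const
  | succ k ih =>
    exact intervalIntegral.continuous_primitive
      (intervalIntegrable_comp_floor hX ht₀ (hS.clm_apply ih.continuousOn)) t₀

omit [SecondCountableTopology E] [CompleteSpace E] in
theorem norm_picard_le (hX : IsClosed X) (ht₀ : t₀ ∈ X) (c : E)
    {b M : ℝ} (hM : ∀ t ∈ Ray X t₀ ∩ Set.Iic b, ‖S t‖ ≤ M) (k : ℕ) {x : ℝ}
    (hx : x ∈ Set.Icc t₀ b) :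
    ‖picard X t₀ S c k x‖ ≤ ‖c‖ * ((M * (x - t₀)) ^ k / k.factorial) := by
  have hM₀ : 0 ≤ M := (norm_nonneg _).trans (hM t₀ ⟨⟨ht₀, Set.self_mem_Ici⟩, hx.1.trans hx.2⟩)
  induction k generalizing x with
  | zero => simp [picard]
  | succ k ih =>
    have hbound : ∀ r ∈ Set.Ioc t₀ x,
        ‖S (floor X t₀ r) (picard X t₀ S c k (floor X t₀ r))‖ ≤
          ‖c‖ * M ^ (k + 1) / k.factorial * (r - t₀) ^ k := by
      intro r hr
      have hmem := floor_mem hX ht₀ r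
      have hle := (floor_le hX ht₀ r).trans_eq (max_eq_left hr.1.le)
      have hb := hle.trans (hr.2.trans hx.2)
      calc _ ≤ ‖S (floor X t₀ r)‖ * ‖picard X t₀ S c k (floor X t₀ r)‖ :=
            (S (floor X t₀ r)).le_opNorm _
        _ ≤ M * (‖c‖ * ((M * (floor X t₀ r - t₀)) ^ k / k.factorial)) :=
            mul_le_mul (hM _ ⟨hmem, hb⟩) (ih ⟨hmem.2, hb⟩) (norm_nonneg _) hM₀
        _ ≤ M * (‖c‖ * ((M * (r - t₀)) ^ k / k.factorial)) := by
            have h₀ : 0 ≤ floor X t₀ r - t₀ := sub_nonneg.2 hmem.2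
            gcongr
        _ = _ := by rw [mul_pow]; ring
    calc _ ≤ ∫ r in t₀..x, ‖c‖ * M ^ (k + 1) / k.factorial * (r - t₀) ^ k :=
          intervalIntegral.norm_integral_le_of_norm_le hx.1 (Eventually.of_forall hbound)
            (Continuous.intervalIntegrable (by fun_prop) _ _)
      _ = _ := by
          rw [intervalIntegral.integral_const_mul,
            intervalIntegral.integral_comp_sub_right (fun r : ℝ => r ^ k), integral_pow,
            Nat.factorial_succ, mul_pow, sub_self]
          push_cast
          have : (k : ℝ) + 1 ≠ 0 := by positivity
          have : (k.factorial : ℝ) ≠ 0 := by positivity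
          field_simp
          ring

/-- The Volterra equation `w x = c + ∫_{t₀}^x S w Δ` has a solution. -/
theorem exists_eq_add_integral (hX : IsClosed X) (ht₀ : t₀ ∈ X)
    (hS : ContinuousOn S (Ray X t₀)) (c : E) :
    ∃ w : ℝ → E, ContinuousOn w (Ray X t₀) ∧ ∀ x, t₀ ≤ x →
      w x = c + ∫ r in t₀..x, S (floor X t₀ r) (w (floor X t₀ r)) := by
  have key : ∀ b, t₀ ≤ b → ∃ C : ℕ → ℝ, Summable C ∧
      ∀ k, ∀ x ∈ Set.Icc t₀ b, ‖picard X t₀ S c k x‖ ≤ C k := by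
    intro b hb
    obtain ⟨M, hM⟩ := (isCompact_Ray_inter_Iic hX b).exists_bound_of_continuousOn
      (hS.mono Set.inter_subset_left)
    have hM₀ : 0 ≤ M := (norm_nonneg _).trans (hM t₀ ⟨⟨ht₀, Set.self_mem_Ici⟩, hb⟩)
    refine ⟨fun k => ‖c‖ * ((M * (b - t₀)) ^ k / k.factorial),
      (Real.summable_pow_div_factorial _).mul_left _, fun k x hx => ?_⟩
    refine (norm_picard_le hX ht₀ c hM k hx).trans ?_
    have h₀ : 0 ≤ x - t₀ := sub_nonneg.2 hx.1
    have h₁ := hx.2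
    beta_reduce
    gcongr
  refine ⟨fun x => ∑' k, picard X t₀ S c k x, fun t ht => ?_, fun x hx => ?_⟩
  · obtain ⟨C, hC, hle⟩ := key (t + 1) (le_trans ht.2 (by linarith))
    have hc := continuousOn_tsum
      (fun k => (continuous_picard hX ht₀ hS c k).continuousOn) hC hle
    refine (hc t ⟨ht.2, by linarith⟩).mono_of_mem_nhdsWithin ?_
    filter_upwards [self_mem_nhdsWithin,
      mem_nhdsWithin_of_mem_nhds (Iio_mem_nhds (lt_add_one t))] with s hs hs'
    exact ⟨hs.2, le_of_lt hs'⟩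
  · obtain ⟨C, hC, hle⟩ := key x hx
    obtain ⟨M, hM⟩ := (isCompact_Ray_inter_Iic hX x).exists_bound_of_continuousOn
      (hS.mono Set.inter_subset_left)
    have hmem : ∀ r ∈ Set.uIoc t₀ x, floor X t₀ r ∈ Set.Icc t₀ x := fun r hr => by
      rw [Set.uIoc_of_le hx] at hr
      exact ⟨(floor_mem hX ht₀ r).2,
        ((floor_le hX ht₀ r).trans_eq (max_eq_left hr.1.le)).trans hr.2⟩
    have hsum : ∀ y ∈ Set.Icc t₀ x, Summable fun k => picard X t₀ S c k y := fun y hy =>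
      hC.of_norm_bounded fun k => hle k y hy
    have hint := intervalIntegral.hasSum_integral_of_dominated_convergence
      (μ := volume) (a := t₀) (b := x)
      (F := fun k r => S (floor X t₀ r) (picard X t₀ S c k (floor X t₀ r)))
      (f := fun r => S (floor X t₀ r) (∑' k, picard X t₀ S c k (floor X t₀ r)))
      (fun k _ => M * C k)
      (fun k => (stronglyMeasurable_comp_floor hX ht₀
        (hS.clm_apply (continuous_picard hX ht₀ hS c k).continuousOn)).aestronglyMeasurable)
      (fun k => Eventually.of_forall fun r hr => by
        have hr' := hmem r hr
        have hMr := hM _ ⟨floor_mem hX ht₀ r, hr'.2⟩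
        exact ((S (floor X t₀ r)).le_opNorm _).trans
          (mul_le_mul hMr (hle k _ hr') (norm_nonneg _) ((norm_nonneg _).trans hMr)))
      (Eventually.of_forall fun r _ => hC.mul_left M)
      intervalIntegrable_const
      (Eventually.of_forall fun r hr =>
        (hsum _ (hmem r hr)).hasSum.mapL (S (floor X t₀ r)))
    beta_reduce
    rw [← hint.tsum_eq, (hsum x ⟨hx, le_rfl⟩).tsum_eq_zero_add]
    rfl

theorem IsSturmian.exists_hasDeltaDerivAt (hX : IsClosed X) (hub : ¬ BddAbove X)
    (ht₀ : t₀ ∈ X) (hSt : IsSturmian X t₀) (hS : ContinuousOn S (Ray X t₀)) (c : E) :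
    ∃ w : ℝ → E, ContinuousOn w (Ray X t₀) ∧ w t₀ = c ∧
      ∀ t ∈ Ray X t₀, HasDeltaDerivAt (Ray X t₀) w (S t (w t)) t := by
  obtain ⟨w, hw, hint⟩ := exists_eq_add_integral hX ht₀ hS c
  refine ⟨w, hw, by simpa using hint t₀ le_rfl, fun t ht => ?_⟩
  have hd := hSt.hasDeltaDerivAt_integral hX hub ht₀ (hS.clm_apply hw) ht
  have hσ : sigma (Ray X t₀) t ∈ Ray X t₀ := (sigma_Ray ht).symm ▸ sigma_mem_Ray hX hub ht
  have hd' : HasDeltaDerivAt (Ray X t₀)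
      (fun x => c + ∫ r in t₀..x, S (floor X t₀ r) (w (floor X t₀ r))) (S t (w t)) t := by
    refine IsLittleO.congr_left hd fun s => ?_
    rw [add_sub_add_left_eq_sub]
  exact hd'.congr hσ fun x hx => hint x hx.2

end Integral

end TimeScale

namespace TimeScale

variable {X : Set ℝ} {t₀ s t : ℝ}

/-! ### Uniqueness for linear dynamic equations -/

section Uniqueness

variable {E : Type*} [NormedAddCommGroup E] [NormedSpace ℝ E] {S : ℝ → E →L[ℝ] E}

/-- Induction principle on the half line of a Sturmian time scale. -/
theorem IsSturmian.ray_induction (hX : IsClosed X) (hub : ¬ BddAbove X) (ht₀ : t₀ ∈ X)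
    (hS : IsSturmian X t₀) {p : ℝ → Prop} (zero : p t₀)
    (scattered : ∀ t ∈ Ray X t₀, t < sigma X t → p t → p (sigma X t))
    (dense : ∀ t ∈ Ray X t₀, sigma X t = t → p t → ∀ᶠ s in 𝓝[Ray X t₀ ∩ Set.Ioi t] t, p s)
    (limit : ∀ t ∈ Ray X t₀, (𝓝[Ray X t₀ ∩ Set.Iio t] t).NeBot →
      (∀ s ∈ Ray X t₀, s < t → p s) → p t)
    (ht : t ∈ Ray X t₀) : p t := by
  by_contra hpt
  set F := {s | s ∈ Ray X t₀ ∧ ¬ p s} with hF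
  have hFne : F.Nonempty := ⟨t, ht, hpt⟩
  have hFbdd : BddBelow F := ⟨t₀, fun s hs => hs.1.2⟩
  set m := sInf F with hm
  have hmT : m ∈ Ray X t₀ :=
    closure_minimal (fun s hs => hs.1) (isClosed_Ray hX) (csInf_mem_closure hFne hFbdd)
  have hlt : ∀ s ∈ Ray X t₀, s < m → p s := fun s hs hsm => by
    by_contra hps
    exact (csInf_le hFbdd ⟨hs, hps⟩).not_gt hsm
  have hpm : p m := by
    rcases (show t₀ ≤ m from hmT.2).eq_or_lt with h₀ | h₀
    · exact h₀ ▸ zero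
    rcases (le_sigma hub m).eq_or_lt with h | h
    · refine limit m hmT ?_ hlt
      rw [← mem_closure_iff_nhdsWithin_neBot, Metric.mem_closure_iff]
      intro ε hε
      obtain ⟨s, hs, hεs, hsm⟩ :=
        hS.exists_mem_Ioo_left ht₀ hmT h.symm h₀ (sub_lt_self m hε)
      refine ⟨s, ⟨hs, hsm⟩, ?_⟩
      rw [Real.dist_eq, abs_of_pos (sub_pos.2 hsm)]
      linarith
    · have hρ : rho X m ∈ Ray X t₀ := ⟨rho_mem hX hmT.1, le_rho ht₀ h₀⟩
      have hρm := hS.rho_lt hmT h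
      have hσ := (hS m hmT).1
      have := scattered _ hρ (hσ.symm ▸ hρm) (hlt _ hρ hρm)
      rwa [hσ] at this
  have hmF : ∀ s ∈ F, m < s := fun s hs =>
    lt_of_le_of_ne (csInf_le hFbdd hs) fun h => hs.2 (h ▸ hpm)
  rcases (le_sigma hub m).eq_or_lt with h | h
  · have hev := dense m hmT h.symm hpm
    rw [eventually_nhdsWithin_iff, Metric.eventually_nhds_iff] at hev
    obtain ⟨ε, hε, hev⟩ := hev
    obtain ⟨s, hs, hsε⟩ := exists_lt_of_csInf_lt hFne (lt_add_of_pos_right m hε)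
    refine hs.2 (hev ?_ ⟨hs.1, hmF s hs⟩)
    rw [Real.dist_eq, abs_of_pos (sub_pos.2 (hmF s hs))]
    linarith
  · obtain ⟨s, hs, hsσ⟩ := exists_lt_of_csInf_lt hFne h
    exact (sigma_le hub hs.1.1 (hmF s hs)).not_gt hsσ

theorem IsSturmian.eq_zero_of_hasDeltaDerivAt (hX : IsClosed X) (hub : ¬ BddAbove X)
    (ht₀ : t₀ ∈ X) (hSt : IsSturmian X t₀) (hS : ContinuousOn S (Ray X t₀)) {d : ℝ → E}
    (hd : ∀ t ∈ Ray X t₀, HasDeltaDerivAt (Ray X t₀) d (S t (d t)) t) (h₀ : d t₀ = 0)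
    (ht : t ∈ Ray X t₀) : d t = 0 := by
  obtain ⟨M, hM⟩ := ((isCompact_Icc (a := t₀) (b := t)).inter_right
    (isClosed_Ray (t₀ := t₀) hX)).exists_bound_of_continuousOn (hS.mono Set.inter_subset_right)
  have hM₀ : 0 ≤ M := (norm_nonneg _).trans (hM t₀ ⟨⟨le_rfl, ht.2⟩, ht₀, Set.self_mem_Ici⟩)
  have step : ∀ {a b : ℝ}, a ∈ Ray X t₀ → a ≤ t →
      ‖d a + (b - a) • S a (d a)‖ ≤ (1 + |b - a| * M) * ‖d a‖ := fun {a b} ha hat => by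
    refine (norm_add_le _ _).trans ?_
    rw [norm_smul, Real.norm_eq_abs, add_mul, one_mul, mul_assoc]
    gcongr
    exact (S a).le_of_opNorm_le (hM a ⟨⟨ha.2, hat⟩, ha⟩) _
  have main : ∀ ε > 0, ‖d t‖ ≤ ε * Real.exp ((M + 1) * (t - t₀)) := by
    intro ε hε
    have grow : ∀ a b : ℝ, a ≤ b →
        (1 + (b - a) * (M + 1)) * (ε * Real.exp ((M + 1) * (a - t₀))) ≤
          ε * Real.exp ((M + 1) * (b - t₀)) := fun a b hab => by
      have h₁ := Real.add_one_le_exp ((b - a) * (M + 1))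
      have h₂ : Real.exp ((M + 1) * (b - t₀)) =
          Real.exp ((b - a) * (M + 1)) * Real.exp ((M + 1) * (a - t₀)) := by
        rw [← Real.exp_add]
        ring_nf
      rw [h₂, mul_left_comm]
      gcongr
      linarith
    refine hSt.ray_induction hX hub ht₀
      (p := fun s => s ≤ t → ‖d s‖ ≤ ε * Real.exp ((M + 1) * (s - t₀)))
      (fun _ => ?_) (fun s hs hsσ ih hst => ?_) (fun s hs hsσ ih => ?_)
      (fun s hs hne ih hst => ?_) ht le_rfl
    · rw [h₀, norm_zero]
      positivity
    · have hle := hsσ.le.trans hst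
      have h₁ := (hd s hs).apply_sigma hs
      rw [sigma_Ray hs] at h₁
      rw [h₁]
      refine (step hs hle).trans (le_trans ?_ (grow s (sigma X s) hsσ.le))
      rw [abs_of_pos (sub_pos.2 hsσ)]
      have := sub_pos.2 hsσ
      have := ih hle
      gcongr
      linarith
    · have h₁ := hd s hs
      unfold HasDeltaDerivAt at h₁
      rw [sigma_Ray hs, hsσ] at h₁
      have h₂ := (h₁.def hε).filter_mono
        (nhdsWithin_mono s (Set.inter_subset_left (t := Set.Ioi s)))
      filter_upwards [h₂, self_mem_nhdsWithin] with r hr hrs hrt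
      have hsr : s < r := hrs.2
      have hle := hsr.le.trans hrt
      have hexp : ε ≤ ε * Real.exp ((M + 1) * (s - t₀)) := by
        have h₀ : 0 ≤ s - t₀ := sub_nonneg.2 hs.2
        exact le_mul_of_one_le_right hε.le (Real.one_le_exp (by positivity))
      have ih' := ih hle
      have hsplit : d r = (d s + (r - s) • S s (d s)) - (d s - d r - (s - r) • S s (d s)) := by
        rw [sub_smul, sub_smul]
        abel
      rw [Real.norm_eq_abs, abs_sub_comm] at hr
      have h₃ := step (b := r) hs hle
      rw [abs_of_pos (sub_pos.2 hsr)] at hr h₃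
      have h₄ := norm_sub_le (d s + (r - s) • S s (d s)) (d s - d r - (s - r) • S s (d s))
      rw [← hsplit] at h₄
      refine le_trans ?_ (grow s r hsr.le)
      have h₅ : (1 + (r - s) * M) * ‖d s‖ ≤
          (1 + (r - s) * M) * (ε * Real.exp ((M + 1) * (s - t₀))) := by
        have := sub_pos.2 hsr
        gcongr
      have h₆ := mul_le_mul_of_nonneg_left hexp (sub_pos.2 hsr).le
      linarith
    · have hc := (hd s hs).continuousWithinAt hub hSt hs
      have hc₁ : Tendsto (fun r => ‖d r‖) (𝓝[Ray X t₀ ∩ Set.Iio s] s) (𝓝 ‖d s‖) :=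
        (hc.mono Set.inter_subset_left).norm
      have hc₂ : Tendsto (fun r => ε * Real.exp ((M + 1) * (r - t₀)))
          (𝓝[Ray X t₀ ∩ Set.Iio s] s) (𝓝 (ε * Real.exp ((M + 1) * (s - t₀)))) :=
        ((by fun_prop : Continuous fun r => ε * Real.exp ((M + 1) * (r - t₀))).tendsto
          s).mono_left nhdsWithin_le_nhds
      refine le_of_tendsto_of_tendsto hc₁ hc₂ ?_
      filter_upwards [self_mem_nhdsWithin] with r hr
      exact ih r hr.1 hr.2 (le_trans (le_of_lt hr.2) hst)
  rw [← norm_le_zero_iff]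
  refine le_of_forall_pos_le_add fun ε hε => ?_
  have h := main (ε / Real.exp ((M + 1) * (t - t₀))) (by positivity)
  rwa [div_mul_cancel₀ _ (Real.exp_pos _).ne', ← zero_add ε] at h

end Uniqueness

end TimeScale

namespace TimeScale

variable {X : Set ℝ} {t₀ s t : ℝ}

/-! ### The delta measure of bounded intervals -/

theorem measurableSet_inter_Ico (hX : IsClosed X) (a b : ℝ) : MeasurableSet (X ∩ Set.Ico a b) :=
  hX.measurableSet.inter measurableSet_Ico

theorem deltaMeasure_Ico_ne_top (hX : IsClosed X) (hub : ¬ BddAbove X) (a b : ℝ) :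
    deltaMeasure X (X ∩ Set.Ico a b) ≠ ⊤ := by
  classical
  have hms := measurableSet_inter_Ico hX a b
  set G : {t : ℝ // t ∈ X ∧ t < sigma X t} → Set ℝ := fun t =>
    if (t : ℝ) ∈ X ∩ Set.Ico a b then Set.Ioo (t : ℝ) (sigma X t) else ∅ with hG
  have hGsub : ∀ t, G t ⊆ Set.Ioo (t : ℝ) (sigma X t) := fun t => by
    simp only [hG]
    split_ifs
    · exact le_rfl
    · exact Set.empty_subset _
  have hdisj : Pairwise (Function.onFun Disjoint G) := by
    have aux : ∀ u v : {t : ℝ // t ∈ X ∧ t < sigma X t}, (u : ℝ) < v → Disjoint (G u) (G v) :=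
      fun u v huv => Set.disjoint_left.2 fun x hxu hxv =>
        ((hGsub u hxu).2.trans_le (sigma_le hub v.2.1 huv)).not_gt (hGsub v hxv).1
    intro u v huv
    rcases lt_or_gt_of_ne (fun h => huv (Subtype.ext h) : (u : ℝ) ≠ v) with h | h
    · exact aux u v h
    · exact (aux v u h).symm
  have hmeas : ∀ t, MeasurableSet (G t) := fun t => by
    simp only [hG]
    split_ifs
    · exact measurableSet_Ioo
    · exact MeasurableSet.empty
  have hunion : ⋃ t, G t ⊆ Set.Icc a (sigma X b) := by
    refine Set.iUnion_subset fun t x hx => ?_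
    by_cases ht : (t : ℝ) ∈ X ∩ Set.Ico a b
    · have hx' := hGsub t hx
      refine ⟨ht.2.1.trans hx'.1.le, hx'.2.le.trans ?_⟩
      exact sigma_le hub (sigma_mem hX hub b) (ht.2.2.trans_le (le_sigma hub b))
    · simp only [hG, if_neg ht] at hx
      exact absurd hx (Set.notMem_empty x)
  have hatoms : (∑' t : {t : ℝ // t ∈ X ∧ t < sigma X t},
      (ENNReal.ofReal (mu X t) • Measure.dirac (t : ℝ)) (X ∩ Set.Ico a b)) ≤ ∑' t, volume (G t) := by
    refine ENNReal.tsum_le_tsum fun t => ?_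
    rw [Measure.smul_apply, Measure.dirac_apply' _ hms, smul_eq_mul]
    by_cases ht : (t : ℝ) ∈ X ∩ Set.Ico a b
    · simp only [hG, if_pos ht, Set.indicator_of_mem ht, Pi.one_apply, mul_one,
        Real.volume_Ioo, mu, le_refl]
    · simp [Set.indicator_of_notMem ht]
  rw [deltaMeasure, Measure.add_apply, Measure.sum_apply _ hms]
  refine ENNReal.add_ne_top.2 ⟨?_, ?_⟩
  · refine ne_top_of_le_ne_top (measure_Ico_lt_top (μ := volume) (a := a) (b := b)).ne ?_
    exact (Measure.restrict_apply_le X _).trans (measure_mono Set.inter_subset_right)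
  · refine ne_top_of_le_ne_top
      (measure_Icc_lt_top (μ := volume) (a := a) (b := sigma X b)).ne (hatoms.trans ?_)
    exact (tsum_meas_le_meas_iUnion_of_disjoint volume hmeas hdisj).trans (measure_mono hunion)

theorem inter_Ico_subset_Ray (b : ℝ) : X ∩ Set.Ico t₀ b ⊆ Ray X t₀ :=
  fun _ h => ⟨h.1, h.2.1⟩

theorem integrableOn_deltaMeasure {E : Type*} [NormedAddCommGroup E] [SecondCountableTopology E]
    (hX : IsClosed X) (hub : ¬ BddAbove X) {f : ℝ → E}
    (hf : ContinuousOn f (Ray X t₀)) (b : ℝ) :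
    IntegrableOn f (X ∩ Set.Ico t₀ b) (deltaMeasure X) := by
  have hms := measurableSet_inter_Ico hX t₀ b
  obtain ⟨C, hC⟩ := (isCompact_Ray_inter_Iic (t₀ := t₀) hX b).exists_bound_of_continuousOn
    (hf.mono Set.inter_subset_left)
  have : IsFiniteMeasure ((deltaMeasure X).restrict (X ∩ Set.Ico t₀ b)) :=
    isFiniteMeasure_restrict.2 (deltaMeasure_Ico_ne_top hX hub t₀ b)
  refine Integrable.of_bound
    ((hf.mono (inter_Ico_subset_Ray b)).aestronglyMeasurable hms) C ?_
  exact (ae_restrict_iff' hms).2 (Eventually.of_forall fun t ht =>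
    hC t ⟨inter_Ico_subset_Ray b ht, ht.2.2.le⟩)

end TimeScale

namespace TimeScaleHamiltonian

open TimeScale Matrix

section Coefficient

variable {n : ℕ}

/-- The coefficient matrix of the Hamiltonian system solved for `ŷ^Δ`, where `P = λ A₁ + B₁` and
`Q = λ A₂ + B₄`. -/
noncomputable def coeff (m : ℂ) (P B₂ B₃ Q : Matrix (Fin n) (Fin n) ℂ) :
    Matrix (Fin n ⊕ Fin n) (Fin n ⊕ Fin n) ℂ :=
  fromBlocks (B₃ - m • (Q * (1 + m • B₂)⁻¹ * P)) (Q * (1 + m • B₂)⁻¹)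
    (-((1 + m • B₂)⁻¹ * P)) (-((1 + m • B₂)⁻¹ * B₂))

theorem J_mulVec_elim (d₁ d₂ : Fin n → ℂ) :
    J (Fin n) ℂ *ᵥ Sum.elim d₁ d₂ = Sum.elim (-d₂) d₁ := by
  rw [J, fromBlocks_mulVec]
  simp [neg_mulVec]

theorem J_mulVec_eq_iff {m : ℂ} {P B₂ B₃ Q : Matrix (Fin n) (Fin n) ℂ}
    (h : IsUnit (1 + m • B₂)) (u v d₁ d₂ : Fin n → ℂ) :
    J (Fin n) ℂ *ᵥ Sum.elim d₁ d₂ = fromBlocks P B₂ B₃ Q *ᵥ Sum.elim u (v + m • d₂) ↔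
      Sum.elim d₁ d₂ = coeff m P B₂ B₃ Q *ᵥ Sum.elim u v := by
  have hdet := (isUnit_iff_isUnit_det _).1 h
  rw [J_mulVec_elim, coeff, fromBlocks_mulVec, fromBlocks_mulVec]
  set R := (1 + m • B₂)⁻¹ with hR
  have hRK : ∀ x, R *ᵥ x + m • R *ᵥ B₂ *ᵥ x = x := fun x => by
    have := congrArg (· *ᵥ x) (nonsing_inv_mul _ hdet)
    simpa [← hR, mul_add, add_mulVec, smul_mulVec, ← mulVec_mulVec] using this
  have hKR : ∀ x, R *ᵥ x + m • B₂ *ᵥ R *ᵥ x = x := fun x => by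
    have := congrArg (· *ᵥ x) (mul_nonsing_inv _ hdet)
    simpa [← hR, add_mul, add_mulVec, smul_mulVec, ← mulVec_mulVec] using this
  have hsec : -d₂ = P *ᵥ u + B₂ *ᵥ (v + m • d₂) ↔ d₂ = -(R *ᵥ P *ᵥ u) - R *ᵥ B₂ *ᵥ v := by
    constructor
    · intro h₁
      have h₂ : d₂ + m • B₂ *ᵥ d₂ = -(P *ᵥ u) - B₂ *ᵥ v := by
        rw [mulVec_add, mulVec_smul] at h₁
        linear_combination (exp := 1) -h₁
      have h₃ := congrArg (R *ᵥ ·) h₂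
      simpa only [mulVec_add, mulVec_sub, mulVec_neg, mulVec_smul, hRK] using h₃
    · intro h₁
      have h₂ := hKR (P *ᵥ u)
      have h₃ := hKR (B₂ *ᵥ v)
      rw [mulVec_add, mulVec_smul, h₁]
      simp only [mulVec_sub, mulVec_neg, smul_sub, smul_neg]
      linear_combination (exp := 1) h₂ + h₃
  have hfst : d₂ = -(R *ᵥ P *ᵥ u) - R *ᵥ B₂ *ᵥ v →
      B₃ *ᵥ u + Q *ᵥ (v + m • d₂) =
        (B₃ - m • (Q * R * P)) *ᵥ u + (Q * R) *ᵥ v := by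
    intro h₁
    have h₂ := congrArg (Q *ᵥ ·) (hRK v)
    simp only [mulVec_add, mulVec_smul] at h₂
    simp only [h₁, mulVec_add, mulVec_sub, mulVec_neg, mulVec_smul, sub_mulVec, smul_mulVec,
      ← mulVec_mulVec, smul_sub, smul_neg]
    linear_combination (exp := 1) -h₂
  simp only [Sum.elim_eq_iff, Sum.elim_comp_inl, Sum.elim_comp_inr, neg_mulVec, ← mulVec_mulVec,
    ← sub_eq_add_neg] at hfst ⊢
  constructor
  · rintro ⟨h₁, h₂⟩
    have h₃ := hsec.1 h₁
    exact ⟨h₂.trans (hfst h₃), h₃⟩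
  · rintro ⟨h₁, h₂⟩
    exact ⟨hsec.2 h₂, h₁.trans (hfst h₂).symm⟩

theorem continuousOn_coeff {T : Set ℝ} {m : ℝ → ℂ} {P B₂ B₃ Q : ℝ → Matrix (Fin n) (Fin n) ℂ}
    (hm : ContinuousOn m T) (hP : ContinuousOn P T) (hB₂ : ContinuousOn B₂ T)
    (hB₃ : ContinuousOn B₃ T) (hQ : ContinuousOn Q T)
    (hinv : ∀ t ∈ T, IsUnit (1 + m t • B₂ t)) :
    ContinuousOn (fun t => coeff (m t) (P t) (B₂ t) (B₃ t) (Q t)) T := by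
  have hR : ContinuousOn (fun t => (1 + m t • B₂ t)⁻¹) T := fun t ht => by
    have hdet := (isUnit_iff_isUnit_det _).1 (hinv t ht)
    have hc : ContinuousAt (fun M : Matrix (Fin n) (Fin n) ℂ => M⁻¹) (1 + m t • B₂ t) := by
      refine continuousAt_matrix_inv _ ?_
      rw [Ring.inverse_eq_inv']
      exact continuousAt_inv₀ hdet.ne_zero
    exact ContinuousAt.comp_continuousWithinAt (f := fun t => 1 + m t • B₂ t) hc
      ((continuousOn_const.add (hm.smul hB₂)) t ht)
  have hblocks : Continuous fun M : (Matrix (Fin n) (Fin n) ℂ × Matrix (Fin n) (Fin n) ℂ) ×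
      (Matrix (Fin n) (Fin n) ℂ × Matrix (Fin n) (Fin n) ℂ) =>
      fromBlocks M.1.1 M.1.2 M.2.1 M.2.2 := by fun_prop
  exact hblocks.comp_continuousOn
    (((hB₃.sub (hm.smul ((hQ.mul hR).mul hP))).prodMk (hQ.mul hR)).prodMk
      ((hR.mul hP).neg.prodMk (hR.mul hB₂).neg))

end Coefficient

section System

variable {n : ℕ} {X : Set ℝ} {t₀ : ℝ} {A₁ A₂ B₁ B₂ B₃ B₄ : ℝ → Matrix (Fin n) (Fin n) ℂ}
  {A B : ℝ → Matrix (Fin n ⊕ Fin n) (Fin n ⊕ Fin n) ℂ}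

/-- The Hamiltonian system is the linear dynamic equation `ŷ^Δ = S ŷ`. -/
theorem satisfiesSystem_iff (hS : IsSturmian X t₀)
    (hA : ∀ t ∈ Ray X t₀, A t = fromBlocks (A₁ t) 0 0 (A₂ t))
    (hB : ∀ t ∈ Ray X t₀, B t = fromBlocks (B₁ t) (B₂ t) (B₃ t) (B₄ t))
    (hinv₂ : ∀ t ∈ Ray X t₀, IsUnit (1 + (mu X t : ℂ) • B₂ t))
    (lam : ℂ) (y₁ y₂ : ℝ → (Fin n → ℂ)) :
    SatisfiesSystem X t₀ A B lam y₁ y₂ ↔ ∀ t ∈ Ray X t₀,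
      HasDeltaDerivAt (Ray X t₀) (hat X y₁ y₂)
        (coeff (mu X t) (lam • A₁ t + B₁ t) (B₂ t) (B₃ t) (lam • A₂ t + B₄ t) *ᵥ
          hat X y₁ y₂ t) t := by
  have key : ∀ t ∈ Ray X t₀, ∀ d, HasDeltaDerivAt (Ray X t₀) (hat X y₁ y₂) d t →
      (J (Fin n) ℂ *ᵥ d = (lam • A t + B t) *ᵥ vec y₁ y₂ t ↔
        d = coeff (mu X t) (lam • A₁ t + B₁ t) (B₂ t) (B₃ t) (lam • A₂ t + B₄ t) *ᵥ
          hat X y₁ y₂ t) := by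
    intro t ht d hd
    have hσ := hd.apply_sigma ht
    rw [sigma_Ray ht] at hσ
    have hy₂ : y₂ t = y₂ (rho X t) + (mu X t : ℂ) • (d ∘ Sum.inr) := by
      ext i
      have := congrFun hσ (Sum.inr i)
      simpa [hat, (hS t ht).2, mu] using this
    have hsum : lam • A t + B t = fromBlocks (lam • A₁ t + B₁ t) (B₂ t) (B₃ t)
        (lam • A₂ t + B₄ t) := by
      rw [hA t ht, hB t ht, fromBlocks_smul, fromBlocks_add]
      simp
    have hiff := J_mulVec_eq_iff (P := lam • A₁ t + B₁ t) (B₃ := B₃ t) (Q := lam • A₂ t + B₄ t)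
      (hinv₂ t ht) (y₁ t) (y₂ (rho X t)) (d ∘ Sum.inl) (d ∘ Sum.inr)
    rwa [Sum.elim_comp_inl_inr, ← hy₂, ← hsum] at hiff
  constructor
  · intro h t ht
    obtain ⟨d, hd, hJ⟩ := h t ht
    rw [← (key t ht d hd).1 hJ]
    exact hd
  · intro h t ht
    exact ⟨_, h t ht, (key t ht _ (h t ht)).2 rfl⟩

theorem memD_of_continuousOn (hX : IsClosed X) (hub : ¬ BddAbove X)
    (hAc : ContinuousOn A (Ray X t₀)) {y₁ y₂ : ℝ → (Fin n → ℂ)}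
    (hy : ContinuousOn (vec y₁ y₂) (Ray X t₀))
    (hd : DeltaDifferentiable (Ray X t₀) (hat X y₁ y₂)) : MemD X t₀ A y₁ y₂ := by
  have hc : ContinuousOn (fun t => star (vec y₁ y₂ t) ⬝ᵥ A t *ᵥ vec y₁ y₂ t) (Ray X t₀) := by
    have hc' : Continuous fun p : Matrix (Fin n ⊕ Fin n) (Fin n ⊕ Fin n) ℂ ×
        (Fin n ⊕ Fin n → ℂ) => star p.2 ⬝ᵥ p.1 *ᵥ p.2 :=
      (continuous_star.comp continuous_snd).dotProduct
        (continuous_fst.matrix_mulVec continuous_snd)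
    exact hc'.comp_continuousOn (f := fun t => (A t, vec y₁ y₂ t)) (hAc.prodMk hy)
  refine ⟨fun b => ⟨(integrableOn_deltaMeasure hX hub hy b).aestronglyMeasurable,
    integrableOn_deltaMeasure hX hub hc b⟩, fun t ht => ?_, fun t ht => ?_⟩
  · obtain ⟨d, hd⟩ := hd t ht
    exact ⟨d ∘ Sum.inl, hd.clm_comp (ContinuousLinearMap.pi fun i : Fin n =>
      ContinuousLinearMap.proj (R := ℝ) (φ := fun _ : Fin n ⊕ Fin n => ℂ) (Sum.inl i))⟩
  · obtain ⟨d, hd⟩ := hd t ht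
    exact ⟨d ∘ Sum.inr, hd.clm_comp (ContinuousLinearMap.pi fun i : Fin n =>
      ContinuousLinearMap.proj (R := ℝ) (φ := fun _ : Fin n ⊕ Fin n => ℂ) (Sum.inr i))⟩

/-- The real-linear operator on `ℂ²ⁿ` given by a matrix. -/
noncomputable def mulVecCLM (n : ℕ) : Matrix (Fin n ⊕ Fin n) (Fin n ⊕ Fin n) ℂ →ₗ[ℝ]
    (Fin n ⊕ Fin n → ℂ) →L[ℝ] (Fin n ⊕ Fin n → ℂ) where
  toFun M := (LinearMap.toContinuousLinearMap M.mulVecLin).restrictScalars ℝ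
  map_add' M N := by
    ext1 x
    exact add_mulVec M N x
  map_smul' c M := by
    ext1 x
    exact smul_mulVec c M x

end System

end TimeScaleHamiltonian

open TimeScale TimeScaleHamiltonian in
theorem mainTheorem1 (n : ℕ) (X : Set ℝ) (hX : IsClosed X) (hXunb : ¬ BddAbove X)
    (t₀ : ℝ) (ht₀ : t₀ ∈ X) (hSturm : IsSturmian X t₀)
    (A₁ A₂ B₁ B₂ B₃ B₄ : ℝ → Matrix (Fin n) (Fin n) ℂ)
    (hA₁ : RdContinuous (Ray X t₀) A₁) (hA₂ : RdContinuous (Ray X t₀) A₂)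
    (hB₁ : RdContinuous (Ray X t₀) B₁) (hB₂ : RdContinuous (Ray X t₀) B₂)
    (hB₃ : RdContinuous (Ray X t₀) B₃) (hB₄ : RdContinuous (Ray X t₀) B₄)
    (A B : ℝ → Matrix (Fin n ⊕ Fin n) (Fin n ⊕ Fin n) ℂ)
    (hA : ∀ t ∈ Ray X t₀, A t = Matrix.fromBlocks (A₁ t) 0 0 (A₂ t))
    (hB : ∀ t ∈ Ray X t₀, B t = Matrix.fromBlocks (B₁ t) (B₂ t) (B₃ t) (B₄ t))
    (hApos : ∀ t ∈ Ray X t₀, (A t).PosSemidef)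
    (hinv₂ : ∀ t ∈ Ray X t₀, IsUnit (1 + (mu X t : ℂ) • B₂ t))
    (hinv₃ : ∀ t ∈ Ray X t₀, IsUnit (1 + (mu X t : ℂ) • B₃ t))
    (lam : ℂ) (c₁ c₂ : Fin n → ℂ) :
    ∃ y₁ y₂ : ℝ → (Fin n → ℂ),
      MemD X t₀ A y₁ y₂ ∧ SatisfiesSystem X t₀ A B lam y₁ y₂ ∧
      hat X y₁ y₂ t₀ = Sum.elim c₁ c₂ ∧
      ∀ z₁ z₂ : ℝ → (Fin n → ℂ), SatisfiesSystem X t₀ A B lam z₁ z₂ →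
        hat X z₁ z₂ t₀ = Sum.elim c₁ c₂ →
        Set.EqOn z₁ y₁ (Ray X t₀) ∧ Set.EqOn z₂ y₂ (Ray X (rho X t₀)) := by

  have hAc : ContinuousOn A (Ray X t₀) := by
    have hblocks : Continuous fun M : Matrix (Fin n) (Fin n) ℂ × Matrix (Fin n) (Fin n) ℂ =>
        Matrix.fromBlocks M.1 0 0 M.2 := by fun_prop
    exact (hblocks.comp_continuousOn ((hA₁.continuousOn hXunb hSturm).prodMk
      (hA₂.continuousOn hXunb hSturm))).congr hA
  have hσc := hSturm.continuousOn_sigma hXunb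
  set S : ℝ → Matrix (Fin n ⊕ Fin n) (Fin n ⊕ Fin n) ℂ := fun t =>
    coeff (mu X t) (lam • A₁ t + B₁ t) (B₂ t) (B₃ t) (lam • A₂ t + B₄ t) with hSdef
  have hSc : ContinuousOn (fun t => mulVecCLM n (S t)) (Ray X t₀) := by
    refine (LinearMap.continuous_of_finiteDimensional (mulVecCLM n)).comp_continuousOn ?_
    exact continuousOn_coeff
      (Complex.continuous_ofReal.comp_continuousOn (hσc.sub continuousOn_id))
      (((hA₁.continuousOn hXunb hSturm).const_smul lam).add (hB₁.continuousOn hXunb hSturm))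
      (hB₂.continuousOn hXunb hSturm) (hB₃.continuousOn hXunb hSturm)
      (((hA₂.continuousOn hXunb hSturm).const_smul lam).add (hB₄.continuousOn hXunb hSturm))
      hinv₂
  have hiff := satisfiesSystem_iff hSturm hA hB hinv₂ lam
  have ht₀' : t₀ ∈ Ray X t₀ := ⟨ht₀, Set.self_mem_Ici⟩
  have hσmem : ∀ t ∈ Ray X t₀, sigma (Ray X t₀) t ∈ Ray X t₀ := fun t ht =>
    (sigma_Ray ht).symm ▸ sigma_mem_Ray hX hXunb ht
  obtain ⟨w, hwc, hw₀, hw⟩ :=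
    hSturm.exists_hasDeltaDerivAt hX hXunb ht₀ hSc (Sum.elim c₁ c₂)
  have hhat : Set.EqOn (hat X (fun t => w t ∘ Sum.inl) fun t => w (sigma X t) ∘ Sum.inr) w
      (Ray X t₀) := fun t ht => by
    rw [hat, (hSturm t ht).1, Sum.elim_comp_inl_inr]
  have hd : ∀ t ∈ Ray X t₀, HasDeltaDerivAt (Ray X t₀)
      (hat X (fun t => w t ∘ Sum.inl) fun t => w (sigma X t) ∘ Sum.inr)
      (Matrix.mulVec (S t)
        (hat X (fun t => w t ∘ Sum.inl) (fun t => w (sigma X t) ∘ Sum.inr) t)) t := by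
    intro t ht
    rw [hhat ht]
    exact (hw t ht).congr (hσmem t ht) hhat
  refine ⟨fun t => w t ∘ Sum.inl, fun t => w (sigma X t) ∘ Sum.inr,
    memD_of_continuousOn hX hXunb hAc ?_ fun t ht => ⟨_, hd t ht⟩, (hiff _ _).2 hd,
    (hhat ht₀').trans hw₀, fun z₁ z₂ hz hz₀ => ?_⟩
  · have hwσ : ContinuousOn (fun t => w (sigma X t)) (Ray X t₀) :=
      hwc.comp hσc fun t ht => sigma_mem_Ray hX hXunb ht
    refine continuousOn_pi.2 fun i => ?_
    rcases i with i | i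
    · exact continuousOn_pi.1 hwc (Sum.inl i)
    · exact continuousOn_pi.1 hwσ (Sum.inr i)
  · have hz' := (hiff z₁ z₂).1 hz
    have heq : Set.EqOn (hat X z₁ z₂) w (Ray X t₀) := fun t ht => by
      rw [← sub_eq_zero]
      refine hSturm.eq_zero_of_hasDeltaDerivAt hX hXunb ht₀ hSc
        (d := fun t => hat X z₁ z₂ t - w t) (fun t ht => ?_) (by rw [hz₀, hw₀, sub_self]) ht
      rw [map_sub]
      exact (hz' t ht).sub (hw t ht)
    have hz₂ : ∀ t ∈ Ray X t₀, z₂ (rho X t) = w t ∘ Sum.inr := fun t ht => by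
      rw [← heq ht, hat, Sum.elim_comp_inr]
    refine ⟨fun t ht => ?_, fun s hs => ?_⟩
    · beta_reduce
      rw [← heq ht, hat, Sum.elim_comp_inl]
    · rcases le_or_gt t₀ s with h | h
      · have hσ := hz₂ _ (sigma_mem_Ray hX hXunb ⟨hs.1, h⟩)
        rwa [(hSturm s ⟨hs.1, h⟩).2] at hσ
      · have hsρ : s = rho X t₀ := le_antisymm (le_rho hs.1 h) hs.2
        have h₀ := hz₂ _ ht₀'
        beta_reduce
        rw [hsρ, (hSturm t₀ ht₀').1, h₀]
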